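/- For an oriented link $L\subset S^3$ let $V_L(q)\in\mathbb{Z}[q,q^{-1}]$ be its Jones polynomial, normalized by $V_{u}=1$ for the unknot $u$ and by the skein relation $$q^{-2}V_{L_+}(q)-q^{2}V_{L_-}(q)=(q^{-1}-q)\,V_{L_0}(q).$$ Equivalently, for any oriented diagram $D$ of $L$, $V_L(q)=\sum_s (q+q^{-1})^{|s|-1}\prod_c w_c(s)$, where $s$ runs over the ways of smoothing every crossing, $|s|$ is the number of resulting closed curves, and $w_c(s)$ is $q^{\varepsilon}$ if $s$ smooths the crossing $c$ of sign $\varepsilon=\pm1$ along the orientation, and $-q^{2\varepsilon}$ if it smooths it against the orientation. For $n\in\mathbb{Z}$ let $KT_{2,n}$ be the Kinoshita–Terasaka knot with parameters $2,n$, oriented either way. It is obtained from the standard diagram of the pretzel link $P(3,-2,2,-3)$, formed by four vertical columns of $3,-2,2,-3$ half twists, by replacing the two horizontal arcs at the top, namely the inner one joining the second column to the third and the outer one joining the first column to the fourth, by a vertical column of $2|n|$ half twists. The two strands of this column are antiparallel, and its crossings are positive if $n>0$ and negative if $n<0$ (so $KT_{2,0}$ is the unknot). Then for every nonzero integer $n$,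 $$V'''_{KT_{2,-n}}(1)=-V'''_{KT_{2,n}}(1),$$ where $'''$ denotes the third derivative with respect to $q$. -/

import Mathlib

open LaurentPolynomial

/-- The combinatorial data of an oriented link diagram (an oriented planar diagram code).
Every crossing records its sign and the four arcs at it: the arc by which the under-strand
arrives, the one by which it leaves, and the same for the over-strand. Every arc runs from a
crossing to a crossing; an arc that meets no crossing is a crossingless circle. -/
structure OrientedCode where
  Crossing : Type
  Arc : Type
  [fintypeCrossing : Fintype Crossing]
  [decidableEqCrossing : DecidableEq Crossing]
  [finiteArc : Finite Arc]
  [nonemptyArc : Nonempty Arc]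
  /-- `true` at a positive crossing, `false` at a negative one -/
  positive : Crossing → Bool
  underIn : Crossing → Arc
  underOut : Crossing → Arc
  overIn : Crossing → Arc
  overOut : Crossing → Arc
  /-- an arc arrives at most once at a crossing -/
  in_injective : Function.Injective (Sum.elim underIn overIn)
  /-- an arc leaves at most one crossing -/
  out_injective : Function.Injective (Sum.elim underOut overOut)
  /-- an arc arrives at a crossing if and only if it leaves one -/
  range_eq : Set.range (Sum.elim underIn overIn) = Set.range (Sum.elim underOut overOut)

attribute [instance] OrientedCode.fintypeCrossing OrientedCode.decidableEqCrossing
  OrientedCode.finiteArc OrientedCode.nonemptyArc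

namespace OrientedCode

/-- Two arcs meet at a crossing. The classes of the equivalence relation generated by it are the
connected components of the diagram, as a subset of the sphere. -/
inductive Meets (D : OrientedCode) : D.Arc → D.Arc → Prop
  | under (c : D.Crossing) : Meets D (D.underIn c) (D.underOut c)
  | over (c : D.Crossing) : Meets D (D.overIn c) (D.overOut c)
  | cross (c : D.Crossing) : Meets D (D.underIn c) (D.overIn c)

/-- The two strands at a crossing turned so that both point upwards and `rising` runs from the
bottom left to the top right: this is the over-strand at a positive crossing and the under-strand
at a negative one. The other strand runs from the bottom right to the top left. -/
def risingIn (D : OrientedCode) (c : D.Crossing) : D.Arc :=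
  if D.positive c then D.overIn c else D.underIn c

/-- See `risingIn`. -/
def risingOut (D : OrientedCode) (c : D.Crossing) : D.Arc :=
  if D.positive c then D.overOut c else D.underOut c

/-- See `risingIn`. -/
def fallingIn (D : OrientedCode) (c : D.Crossing) : D.Arc :=
  if D.positive c then D.underIn c else D.overIn c

/-- See `risingIn`. -/
def fallingOut (D : OrientedCode) (c : D.Crossing) : D.Arc :=
  if D.positive c then D.underOut c else D.overOut c

/-- Every arc `e` has a left side `(e, true)` and a right side `(e, false)`. Two sides border the
same quadrant (top, right, bottom, left) at a crossing. The classes of the equivalence relation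
generated by it are the boundary curves of the faces of the diagram. -/
inductive SameFace (D : OrientedCode) : D.Arc × Bool → D.Arc × Bool → Prop
  | top (c : D.Crossing) : SameFace D (D.risingOut c, true) (D.fallingOut c, false)
  | right (c : D.Crossing) : SameFace D (D.risingOut c, false) (D.fallingIn c, false)
  | bottom (c : D.Crossing) : SameFace D (D.fallingIn c, true) (D.risingIn c, false)
  | left (c : D.Crossing) : SameFace D (D.risingIn c, true) (D.fallingOut c, true)

/-- The code is one of a diagram on the sphere: Euler's formula `V - E + F = 2` on every
connected component, where `E = 2 V` (and `V = 0`, `F = 2` for a crossingless circle), summed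
over the components. -/
def IsPlanar (D : OrientedCode) : Prop :=
  Nat.card (Quot D.SameFace) = Nat.card D.Crossing + 2 * Nat.card (Quot D.Meets)

/-- A state `s` smooths every crossing in one of the two ways: along the orientation if
`s c = true`, against it if `s c = false`. Two arcs are directly joined by the smoothing. -/
inductive Joined (D : OrientedCode) (s : D.Crossing → Bool) : D.Arc → D.Arc → Prop
  | along₁ (c : D.Crossing) (h : s c = true) : Joined D s (D.underIn c) (D.overOut c)
  | along₂ (c : D.Crossing) (h : s c = true) : Joined D s (D.overIn c) (D.underOut c)
  | against₁ (c : D.Crossing) (h : s c = false) : Joined D s (D.underIn c) (D.overIn c)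
  | against₂ (c : D.Crossing) (h : s c = false) : Joined D s (D.underOut c) (D.overOut c)

/-- The number of closed curves into which the diagram falls when it is smoothed by `s`. -/
noncomputable def loops (D : OrientedCode) (s : D.Crossing → Bool) : ℕ :=
  Nat.card (Quot (D.Joined s))

/-- The contribution of a crossing to a state: `q` and `-q ^ 2` for the smoothing along and
against the orientation at a positive crossing, `q⁻¹` and `-q⁻²` at a negative one. -/
noncomputable def weight (D : OrientedCode) (s : D.Crossing → Bool) (c : D.Crossing) : ℤ[T;T⁻¹] :=
  match D.positive c, s c with
  | true, true => T 1
  | true, false => -T 2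
  | false, true => T (-1)
  | false, false => -T (-2)

end OrientedCode

/-- An oriented link diagram (on the sphere). -/
structure LinkDiagram extends OrientedCode where
  planar : toOrientedCode.IsPlanar

/-- The Jones polynomial of the oriented link with diagram `D`, as Kauffman's state sum: the
bracket polynomial multiplied by `(-A ^ 3) ^ (-writhe)`, with `A ^ (-2) = -q`, so that a loop
counts `-A ^ 2 - A ^ (-2) = q + q⁻¹`. It takes the value `1` at the unknot, and because of
`q⁻² (q x - q² y) - q² (q⁻¹ x - q⁻² y) = (q⁻¹ - q) x` it satisfies the skein relation
`q⁻² V(L₊) - q² V(L₋) = (q⁻¹ - q) V(L₀)`. -/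
noncomputable def LinkDiagram.jones (D : LinkDiagram) : ℤ[T;T⁻¹] :=
  ∑ s : D.Crossing → Bool, (∏ c, D.weight s c) * (T 1 + T (-1)) ^ (D.loops s - 1)

/-- The function on the nonzero reals given by a Laurent polynomial. -/
noncomputable def laurentFun (V : ℤ[T;T⁻¹]) (q : ℝ) : ℝ :=
  V.coeff.sum fun k a => (a : ℝ) * q ^ k

namespace KT2

/-- The crossings of `KT_{2,n}`: ten in the four columns of the pretzel link `P(3, -2, 2, -3)`
(numbered from left to right, and from top to bottom in each column: `0, 1, 2`, then `3, 4`, then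
`5, 6`, then `7, 8, 9`), and `2 |n|` in the clasp. -/
abbrev Cr (n : ℤ) : Type := Fin 10 ⊕ Fin (2 * n.natAbs)

/-- The arcs of `KT_{2,n}`: eighteen outside the clasp, and `2 |n| + 1` on each of the two strands
`a`, `b` of the clasp, numbered from top to bottom. Along the knot, in the direction of its orientation, the arcs are
`a_0, ..., a_{2|n|}, 0, 1, 2, b_{2|n|}, ..., b_0, 3, 4, ..., 17`. -/
abbrev Ar (n : ℤ) : Type := Fin 18 ⊕ (Fin (2 * n.natAbs + 1) ⊕ Fin (2 * n.natAbs + 1))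

/-- An arc outside the clasp. -/
abbrev o {n : ℤ} (i : Fin 18) : Ar n := Sum.inl i

/-- An arc on strand `a`, which runs downwards through the clasp. -/
abbrev a {n : ℤ} (j : Fin (2 * n.natAbs + 1)) : Ar n := Sum.inr (Sum.inl j)

/-- An arc on strand `b`, which runs upwards through the clasp. -/
abbrev b {n : ℤ} (j : Fin (2 * n.natAbs + 1)) : Ar n := Sum.inr (Sum.inr j)

/-- Is `a` the over-strand at the `j`-th crossing of the clasp, counted from the top? At even `j`
strand `a` runs from the top left to the bottom right and `b` from the bottom left to the top right,
so that `a` is the over-strand if the crossing is positive and the under-strand if it is negative;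
and conversely at odd `j`, where `a` comes from the top right and `b` from the bottom right. -/
def aOver (n : ℤ) (j : Fin (2 * n.natAbs)) : Bool := decide (j.val % 2 = 0) == decide (0 < n)

/-- The signs: the columns have three positive, two negative, two positive and three negative
crossings, and the clasp has crossings of the sign of `n`. -/
def positive (n : ℤ) : Cr n → Bool
  | .inl i => ![true, true, true, false, false, true, true, false, false, false] i
  | .inr _ => decide (0 < n)

def underIn (n : ℤ) : Cr n → Ar n
  | .inl i => ![o 17, o 11, o 15, a (Fin.last _), o 14, o 2, o 5, b 0, o 8, o 4] i
  | .inr j => if aOver n j then b j.succ else a j.castSucc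

def underOut (n : ℤ) : Cr n → Ar n
  | .inl i => ![a 0, o 12, o 16, o 0, o 15, b (Fin.last _), o 6, o 3, o 9, o 5] i
  | .inr j => if aOver n j then b j.castSucc else a j.succ

def overIn (n : ℤ) : Cr n → Ar n
  | .inl i => ![o 12, o 16, o 10, o 13, o 0, o 6, o 1, o 7, o 3, o 9] i
  | .inr j => if aOver n j then a j.castSucc else b j.succ

def overOut (n : ℤ) : Cr n → Ar n
  | .inl i => ![o 13, o 17, o 11, o 14, o 1, o 7, o 2, o 8, o 4, o 10] i
  | .inr j => if aOver n j then a j.succ else b j.castSucc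

def inInv (n : ℤ) : Ar n → Cr n ⊕ Cr n
  | .inl i => ![.inr (.inl 4), .inr (.inl 6), .inl (.inl 5), .inr (.inl 8), .inl (.inl 9),
      .inl (.inl 6), .inr (.inl 5), .inr (.inl 7), .inl (.inl 8), .inr (.inl 9), .inr (.inl 2),
      .inl (.inl 1), .inr (.inl 0), .inr (.inl 3), .inl (.inl 4), .inl (.inl 2), .inr (.inl 1),
      .inl (.inl 0)] i
  | .inr (.inl j) => Fin.lastCases (.inl (.inl 3))
      (fun j => if aOver n j then .inr (.inr j) else .inl (.inr j)) j
  | .inr (.inr j) => Fin.cases (.inl (.inl 7))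
      (fun j => if aOver n j then .inl (.inr j) else .inr (.inr j)) j

def outInv (n : ℤ) : Ar n → Cr n ⊕ Cr n
  | .inl i => ![.inl (.inl 3), .inr (.inl 4), .inr (.inl 6), .inl (.inl 7), .inr (.inl 8),
      .inl (.inl 9), .inl (.inl 6), .inr (.inl 5), .inr (.inl 7), .inl (.inl 8), .inr (.inl 9),
      .inr (.inl 2), .inl (.inl 1), .inr (.inl 0), .inr (.inl 3), .inl (.inl 4), .inl (.inl 2),
      .inr (.inl 1)] i
  | .inr (.inl j) => Fin.cases (.inl (.inl 0))
      (fun j => if aOver n j then .inr (.inr j) else .inl (.inr j)) j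
  | .inr (.inr j) => Fin.lastCases (.inl (.inl 5))
      (fun j => if aOver n j then .inl (.inr j) else .inr (.inr j)) j

theorem in_left (n : ℤ) : Function.LeftInverse (inInv n) (Sum.elim (underIn n) (overIn n)) := by
  rintro ((i | j) | (i | j))
  · fin_cases i <;> simp [underIn, inInv]
  · by_cases h : aOver n j <;> simp [underIn, inInv, h]
  · fin_cases i <;> simp [overIn, inInv]
  · by_cases h : aOver n j <;> simp [overIn, inInv, h]

theorem out_left (n : ℤ) :
    Function.LeftInverse (outInv n) (Sum.elim (underOut n) (overOut n)) := by
  rintro ((i | j) | (i | j))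
  · fin_cases i <;> simp [underOut, outInv]
  · by_cases h : aOver n j <;> simp [underOut, outInv, h]
  · fin_cases i <;> simp [overOut, outInv]
  · by_cases h : aOver n j <;> simp [overOut, outInv, h]

theorem in_right (n : ℤ) : Function.RightInverse (inInv n) (Sum.elim (underIn n) (overIn n)) := by
  rintro (i | j | j)
  · fin_cases i <;> simp [underIn, overIn, inInv]
  · refine Fin.lastCases ?_ (fun j => ?_) j
    · simp [underIn, inInv]
    · by_cases h : aOver n j <;> simp [underIn, overIn, inInv, h]
  · refine Fin.cases ?_ (fun j => ?_) j
    · simp [underIn, inInv]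
    · by_cases h : aOver n j <;> simp [underIn, overIn, inInv, h]

theorem out_right (n : ℤ) :
    Function.RightInverse (outInv n) (Sum.elim (underOut n) (overOut n)) := by
  rintro (i | j | j)
  · fin_cases i <;> simp [underOut, overOut, outInv]
  · refine Fin.cases ?_ (fun j => ?_) j
    · simp [underOut, outInv]
    · by_cases h : aOver n j <;> simp [underOut, overOut, outInv, h]
  · refine Fin.lastCases ?_ (fun j => ?_) j
    · simp [underOut, outInv]
    · by_cases h : aOver n j <;> simp [underOut, overOut, outInv, h]

def code (n : ℤ) : OrientedCode where
  Crossing := Cr n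
  Arc := Ar n
  positive := positive n
  underIn := underIn n
  underOut := underOut n
  overIn := overIn n
  overOut := overOut n
  in_injective := (in_left n).injective
  out_injective := (out_left n).injective
  range_eq := by rw [(in_right n).surjective.range_eq, (out_right n).surjective.range_eq]

theorem rising_falling (n : ℤ) (j : Fin (2 * n.natAbs)) :
    if j.val % 2 = 0 then
      (code n).risingIn (.inr j) = a j.castSucc ∧ (code n).risingOut (.inr j) = a j.succ ∧
      (code n).fallingIn (.inr j) = b j.succ ∧ (code n).fallingOut (.inr j) = b j.castSucc
    else
      (code n).risingIn (.inr j) = b j.succ ∧ (code n).risingOut (.inr j) = b j.castSucc ∧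
      (code n).fallingIn (.inr j) = a j.castSucc ∧ (code n).fallingOut (.inr j) = a j.succ := by
  by_cases hn : 0 < n <;> by_cases h : j.val % 2 = 0 <;>
    simp [OrientedCode.risingIn, OrientedCode.risingOut, OrientedCode.fallingIn,
      OrientedCode.fallingOut, code, positive, underIn, underOut, overIn, overOut, aOver, hn, h]

theorem const_of_meets (n : ℤ) {α : Type} (Q : Ar n → α)
    (u : ∀ c, Q (underIn n c) = Q (underOut n c)) (v : ∀ c, Q (overIn n c) = Q (overOut n c))
    (x : ∀ c, Q (underIn n c) = Q (overIn n c)) (e : Ar n) : Q e = Q (o 0) := by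
  have hout : (∀ i : Fin 18, Q (o i) = Q (o 0)) ∧ Q (a 0) = Q (o 0) ∧ Q (b 0) = Q (o 0) := by
    have u' := fun i => u (.inl i)
    have v' := fun i => v (.inl i)
    have x' := fun i => x (.inl i)
    clear u v x
    simp [underIn, underOut, overIn, overOut, Fin.forall_fin_succ] at u' v' x'
    simp only [Fin.forall_fin_succ]
    simp
    grind
  have hab : ∀ j, Q (a j) = Q (o 0) ∧ Q (b j) = Q (o 0) := by
    intro j
    induction j using Fin.induction with
    | zero => exact hout.2
    | succ j ih =>
      have u := u (.inr j)
      have v := v (.inr j)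
      by_cases h : aOver n j <;> simp [underIn, underOut, overIn, overOut, h] at u v <;> grind
  rcases e with i | j | j
  · exact hout.1 i
  · exact (hab j).1
  · exact (hab j).2

theorem card_meets (n : ℤ) : Nat.card (Quot (code n).Meets) = 1 := by
  rw [Nat.card_eq_one_iff_unique]
  have key := const_of_meets n (fun e => Quot.mk (code n).Meets e)
    (fun c => Quot.sound (OrientedCode.Meets.under (D := code n) c))
    (fun c => Quot.sound (OrientedCode.Meets.over (D := code n) c))
    (fun c => Quot.sound (OrientedCode.Meets.cross (D := code n) c))
  refine ⟨⟨?_⟩, ⟨Quot.mk _ (o 0 : Ar n)⟩⟩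
  rintro ⟨e⟩ ⟨e'⟩
  exact (key e).trans (key e').symm

/-- The faces of the diagram: eleven, and one between the two strands at each level of the
clasp. -/
def face (n : ℤ) : Ar n × Bool → Fin 11 ⊕ Fin (2 * n.natAbs + 1)
  | (.inl i, true) => ![.inl 0, .inr (Fin.last _), .inl 3, .inl 5, .inr 0, .inl 2,
      .inr (Fin.last _), .inl 7, .inr 0, .inl 6, .inr 0, .inl 8, .inr 0, .inl 10,
      .inr (Fin.last _), .inl 2, .inr 0, .inl 9] i
  | (.inl i, false) => ![.inl 1, .inl 2, .inl 4, .inl 4, .inl 6, .inl 4, .inl 3, .inl 4, .inl 5,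
      .inl 4, .inl 2, .inl 1, .inl 9, .inl 1, .inl 0, .inl 1, .inl 8, .inl 1] i
  | (.inr (.inl j), s) => if decide (j.val % 2 = 0) = s then .inr j else
      .inl (if s then 7 else 10)
  | (.inr (.inr j), s) => if decide (j.val % 2 = 0) = s then .inr j else
      .inl (if s then 10 else 7)

def side (n : ℤ) : Fin 11 ⊕ Fin (2 * n.natAbs + 1) → Ar n × Bool
  | .inl k => ![(o 0, true), (o 0, false), (o 1, false), (o 2, true), (o 2, false), (o 3, true),
      (o 4, false), (o 7, true), (o 11, true), (o 12, false), (o 13, true)] k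
  | .inr j => (a j, decide (j.val % 2 = 0))

theorem face_side (n : ℤ) (k : Fin 11 ⊕ Fin (2 * n.natAbs + 1)) : face n (side n k) = k := by
  rcases k with k | j
  · fin_cases k <;> simp [face, side]
  · simp [face, side]

theorem face_eq (n : ℤ) (x y : Ar n × Bool) (h : (code n).SameFace x y) :
    face n x = face n y := by
  have hl : (2 * n.natAbs) % 2 = 0 := by omega
  rcases h with c | c | c | c <;> rcases c with i | j
  all_goals first
    | (fin_cases i <;> simp [face, OrientedCode.risingIn, OrientedCode.risingOut,
        OrientedCode.fallingIn, OrientedCode.fallingOut, code, positive, underIn, underOut,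
        overIn, overOut, hl])
    | (have hj := rising_falling n j
       by_cases h : j.val % 2 = 0
       · rw [if_pos h] at hj
         have h' : ¬ (j.val + 1) % 2 = 0 := by omega
         simp [hj, face, h, h']
       · rw [if_neg h] at hj
         have h' : (j.val + 1) % 2 = 0 := by omega
         simp [hj, face, h, h'])

theorem const_of_sameFace (n : ℤ) {α : Type} (Q : Ar n × Bool → α)
    (hQ : ∀ x y, (code n).SameFace x y → Q x = Q y) (x : Ar n × Bool) :
    Q (side n (face n x)) = Q x := by
  have hl : (2 * n.natAbs) % 2 = 0 := by omega
  have t := fun c => hQ _ _ (OrientedCode.SameFace.top (D := code n) c)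
  have r := fun c => hQ _ _ (OrientedCode.SameFace.right (D := code n) c)
  have d := fun c => hQ _ _ (OrientedCode.SameFace.bottom (D := code n) c)
  have l := fun c => hQ _ _ (OrientedCode.SameFace.left (D := code n) c)
  clear hQ
  have hout : (∀ i : Fin 18, ∀ s : Bool, Q (side n (face n (o i, s))) = Q (o i, s)) ∧
      (∀ s, Q (side n (face n (a 0, s))) = Q (a 0, s)) ∧
      (∀ s, Q (side n (face n (b 0, s))) = Q (b 0, s)) := by
    have t' := fun i : Fin 10 => t (.inl i)
    have r' := fun i : Fin 10 => r (.inl i)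
    have d' := fun i : Fin 10 => d (.inl i)
    have l' := fun i : Fin 10 => l (.inl i)
    clear t r d l
    simp [OrientedCode.risingIn, OrientedCode.risingOut,
        OrientedCode.fallingIn, OrientedCode.fallingOut, code, positive, underIn, underOut,
        overIn, overOut, Fin.forall_fin_succ] at t' r' d' l'
    simp only [Fin.forall_fin_succ, Bool.forall_bool]
    simp [face, side, hl]
    grind
  have hab : ∀ j, (∀ s, Q (side n (face n (a j, s))) = Q (a j, s)) ∧
      (∀ s, Q (side n (face n (b j, s))) = Q (b j, s)) := by
    intro j
    induction j using Fin.induction with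
    | zero => exact hout.2
    | succ j ih =>
      have hj := rising_falling n j
      have t' := t (.inr j)
      have r' := r (.inr j)
      have d' := d (.inr j)
      have l' := l (.inr j)
      clear t r d l hout
      by_cases h : j.val % 2 = 0
      · rw [if_pos h] at hj
        have h' : ¬ (j.val + 1) % 2 = 0 := by omega
        rw [hj.1, hj.2.2.2] at l'
        rw [hj.2.1, hj.2.2.1] at r'
        rw [hj.2.1, hj.2.2.2] at t'
        rw [hj.1, hj.2.2.1] at d'
        clear hj
        simp [face, side, h] at ih
        simp [face, side, h']
        exact ⟨ih.2.1.trans t'.symm, r', ih.1.trans d'.symm⟩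
      · rw [if_neg h] at hj
        have h' : (j.val + 1) % 2 = 0 := by omega
        rw [hj.1, hj.2.2.2] at l'
        rw [hj.2.1, hj.2.2.1] at r'
        rw [hj.2.1, hj.2.2.2] at t'
        rw [hj.1, hj.2.2.1] at d'
        clear hj
        simp [face, side, h] at ih
        simp [face, side, h']
        exact ⟨ih.2.2.trans t', ih.1.trans d', l'.symm⟩
  rcases x with ⟨i | j | j, s⟩
  · exact hout.1 i s
  · exact (hab j).1 s
  · exact (hab j).2 s

theorem planar (n : ℤ) : (code n).IsPlanar := by
  let e : Quot (code n).SameFace ≃ Fin 11 ⊕ Fin (2 * n.natAbs + 1) :=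
    { toFun := Quot.lift (face n) (face_eq n)
      invFun := fun k => Quot.mk _ (side n k)
      left_inv := by
        rintro ⟨x⟩
        exact const_of_sameFace n (Quot.mk _) (fun _ _ => Quot.sound) x
      right_inv := face_side n }
  have hc : Nat.card (code n).Crossing = 10 + 2 * n.natAbs := by
    change Nat.card (Cr n) = _
    simp
  rw [OrientedCode.IsPlanar, Nat.card_congr e, card_meets, hc]
  simp
  omega

end KT2

/-- The Kinoshita-Terasaka knot `KT_{2,n}`: four columns of `3, -2, 2, -3` vertical half twists
side by side (counted with the signs of the crossings), neighbouring ones joined by arcs at the top between the first two and the last two,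
and at the bottom between all, the outermost bottom ends joined by an arc around the outside; and
above them the clasp, a column of `2 n` vertical half twists, whose four ends are joined to the four
remaining top ends of the columns (the top left end to that of the first column, the bottom left end
to that of the second, the bottom right end to that of the third, the top right end to that of the
fourth). The strands run upwards in the first and third columns, downwards in the second and fourth
ones, and antiparallel in the clasp. At `n = 0` this is the unknot, and two horizontal arcs in the place of the clasp give the
pretzel link `P(3, -2, 2, -3)`. -/
def KT2 (n : ℤ) : LinkDiagram where
  toOrientedCode := KT2.code n
  planar := KT2.planar n

/-! Write `d = q + q⁻¹` for the value of a loop. The states are sorted by what they do to the clasp.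
If every clasp crossing is smoothed against the orientation, the clasp becomes two vertical strands
and the diagram of `KT_{2,0}`, an unknot, remains. If `k ≥ 1` of them are smoothed along it, the
clasp becomes a cap, a cup and `k - 1` circles, and the diagram of the pretzel link `P(3, -2, 2,
-3)` remains (`loops_of_forall`, `loops_of_exists`).

The two weights `w` at a clasp crossing satisfy `w true * d + w false = 1`, so all clasp states can
be summed at once (`sum_column`). As `(w false) ^ (2|n|) = q ^ (4n)`, the result is `d V = q ^ (4n)
d + (1 - q ^ (4n)) P`, where `P` is the state sum of the pretzel link. A finite computation
(`stateCoeffs_unknot`, `stateCoeffs_pretzel`) gives the unknot the value `1` and `P = d (1 - R)`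
with `R = pretzelDefect`, hence `V = 1 + (q ^ (4n) - 1) R` (`laurentFun_jones_KT2`).

Adding the formulas for `n` and `-n` gives `2 + (q ^ (4n) + q ^ (-4n) - 2) R`. Both factors of the
product vanish to second order at `q = 1`, so the product vanishes to fourth order and the third
derivative of the sum is zero. -/

/-! ### Computable state sums of small diagrams. -/

theorem Nat.card_quot_congr {A B : Type*} {r : A → A → Prop} {r' : B → B → Prop} (f : A → B)
    (g : B → A) (hf : ∀ x y, r x y → Quot.mk r' (f x) = Quot.mk r' (f y))
    (hg : ∀ x y, r' x y → Quot.mk r (g x) = Quot.mk r (g y))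
    (hgf : ∀ x, Quot.mk r (g (f x)) = Quot.mk r x)
    (hfg : ∀ y, Quot.mk r' (f (g y)) = Quot.mk r' y) :
    Nat.card (Quot r) = Nat.card (Quot r') :=
  Nat.card_congr
    { toFun := Quot.lift (fun x => Quot.mk r' (f x)) hf
      invFun := Quot.lift (fun x => Quot.mk r (g x)) hg
      left_inv := by rintro ⟨x⟩; exact hgf x
      right_inv := by rintro ⟨x⟩; exact hfg x }

/-- A crossing of a diagram with vertex set `V`: its sign and the classes of its four arcs. -/
structure VertexCrossing (V : Type) where
  positive : Bool
  underIn : V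
  underOut : V
  overIn : V
  overOut : V

namespace VertexCrossing

variable {V : Type}

/-- The first end of the first edge is `underIn`; this is the second one in the smoothing `b`. -/
def firstEnd (c : VertexCrossing V) (b : Bool) : V := bif b then c.overOut else c.overIn

/-- The first end of the second edge is `underOut`; this is the second one in the
smoothing `b`. -/
def secondEnd (c : VertexCrossing V) (b : Bool) : V := bif b then c.overIn else c.overOut

/-- Two vertices carry the same label or are joined by the state `s`. -/
def Adj {k : ℕ} (lab : V → ℕ) (c : Fin k → VertexCrossing V) (s : Fin k → Bool) (x y : V) : Prop :=
  lab x = lab y ∨ ∃ i, x = (c i).underIn ∧ y = (c i).firstEnd (s i) ∨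
    x = (c i).underOut ∧ y = (c i).secondEnd (s i)

/-- The crossing obtained by replacing every vertex by its label. -/
def map (lab : V → ℕ) (c : VertexCrossing V) : VertexCrossing ℕ :=
  ⟨c.positive, lab c.underIn, lab c.underOut, lab c.overIn, lab c.overOut⟩

end VertexCrossing

/-- Sum of polynomials given by their lists of coefficients. -/
def addCoeffs : List ℤ → List ℤ → List ℤ
  | [], p => p
  | p, [] => p
  | x :: p, y :: p' => (x + y) :: addCoeffs p p'

/-- Value of the polynomial with a given list of coefficients. -/
def evalCoeffs (q : ℝ) : List ℤ → ℝ
  | [] => 0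
  | x :: p => x + q * evalCoeffs q p

/-- Coefficients of `(q ^ 2 + 1) ^ k`. -/
def circleCoeffs : ℕ → List ℤ
  | 0 => [1]
  | k + 1 => addCoeffs (circleCoeffs k) (0 :: 0 :: circleCoeffs k)

/-- Coefficients of `q ^ M * (q + q⁻¹) ^ k`, for `k ≤ M`. -/
def loopCoeffs (M k : ℕ) : List ℤ := List.replicate (M - k) 0 ++ circleCoeffs k

/-- Replace `x` by `y`. -/
def relabel (x y z : ℕ) : ℕ := bif Nat.beq z x then y else z

/-- `n - 1` if `x` and `y` differ: the number of labels that are left when `x` is replaced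
by `y`. -/
def joinCount (x y n : ℕ) : ℕ := bif Nat.beq x y then n else n - 1

/-- Coefficients of `q ^ M` times the state sum of the first `k` crossings in the list, on `n` vertices,
if the weights are multiplied by `q ^ 2` at negative crossings. -/
def stateCoeffs (M : ℕ) : ℕ → List (VertexCrossing ℕ) → ℕ → List ℤ
  | 0, _, n => loopCoeffs M (n - 1)
  | _, [], n => loopCoeffs M (n - 1)
  | k + 1, c :: cs, n =>
    let p (b : Bool) :=
      let x := relabel c.underIn (c.firstEnd b) c.underOut
      let y := relabel c.underIn (c.firstEnd b) (c.secondEnd b)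
      stateCoeffs M k
        (cs.map fun c' => c'.map fun z => relabel x y (relabel c.underIn (c.firstEnd b) z))
        (joinCount x y (joinCount c.underIn (c.firstEnd b) n))
    addCoeffs (0 :: p true) (bif c.positive then 0 :: 0 :: (p false).map Neg.neg
      else (p false).map Neg.neg)

/-- The weights of the smoothings, multiplied by `q ^ 2` at a negative crossing. -/
def normWeight (q : ℝ) : Bool → Bool → ℝ
  | _, true => q
  | true, false => -q ^ 2
  | false, false => -1

theorem evalCoeffs_addCoeffs (q : ℝ) (p p' : List ℤ) :
    evalCoeffs q (addCoeffs p p') = evalCoeffs q p + evalCoeffs q p' := by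
  induction p generalizing p' with
  | nil => simp [addCoeffs, evalCoeffs]
  | cons x p ih =>
    cases p' with
    | nil => simp [addCoeffs, evalCoeffs]
    | cons y p' => simp [addCoeffs, evalCoeffs, ih]; ring

theorem evalCoeffs_neg (q : ℝ) (p : List ℤ) :
    evalCoeffs q (p.map Neg.neg) = -evalCoeffs q p := by
  induction p with
  | nil => simp [evalCoeffs]
  | cons x p ih => simp [evalCoeffs, ih]; ring

theorem evalCoeffs_circleCoeffs (q : ℝ) (k : ℕ) :
    evalCoeffs q (circleCoeffs k) = (q ^ 2 + 1) ^ k := by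
  induction k with
  | zero => simp [circleCoeffs, evalCoeffs]
  | succ k ih => simp [circleCoeffs, evalCoeffs_addCoeffs, evalCoeffs, ih]; ring

theorem evalCoeffs_replicate_append (q : ℝ) (k : ℕ) (p : List ℤ) :
    evalCoeffs q (List.replicate k 0 ++ p) = q ^ k * evalCoeffs q p := by
  induction k with
  | zero => simp
  | succ k ih => simp [List.replicate_succ, evalCoeffs, ih]; ring

theorem evalCoeffs_loopCoeffs {q : ℝ} (hq : q ≠ 0) {M k : ℕ} (h : k ≤ M) :
    evalCoeffs q (loopCoeffs M k) = q ^ M * (q + q⁻¹) ^ k := by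
  rw [loopCoeffs, evalCoeffs_replicate_append, evalCoeffs_circleCoeffs]
  have : q ^ 2 + 1 = q * (q + q⁻¹) := by field_simp
  rw [this, mul_pow, ← mul_assoc, ← pow_add, Nat.sub_add_cancel h]

theorem relabel_eq (x y z : ℕ) : relabel x y z = if z = x then y else z := by
  by_cases h : z = x
  · simp [relabel, h]
  · simp [relabel, h, mt Nat.eq_of_beq_eq_true h]

/-- If the two labels differ, replacing one by the other removes exactly the label of `x` from the
range. -/
theorem joinCount_card_range {V : Type} [Finite V] (lab : V → ℕ) (x y : V) :
    joinCount (lab x) (lab y) (Set.range lab).ncard =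
      (Set.range fun z => relabel (lab x) (lab y) (lab z)).ncard := by
  simp only [relabel_eq]
  by_cases h : lab x = lab y
  · simp only [joinCount, h, Nat.beq_refl, cond_true]
    congr 1
    ext z
    grind
  · have hb : Nat.beq (lab x) (lab y) = false :=
      Bool.eq_false_iff.2 (mt Nat.eq_of_beq_eq_true h)
    rw [joinCount, hb, cond_false, ← Set.ncard_sdiff_singleton_of_mem (Set.mem_range_self x)]
    congr 1
    ext z
    simp only [Set.mem_sdiff, Set.mem_range, Set.mem_singleton_iff]
    constructor
    · rintro ⟨⟨w, rfl⟩, hw⟩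
      exact ⟨w, if_neg hw⟩
    · rintro ⟨w, rfl⟩
      split_ifs with hw
      · exact ⟨⟨y, rfl⟩, fun e => h e.symm⟩
      · exact ⟨⟨w, rfl⟩, hw⟩

/-- The universal property of merging two labels. With `Q` a quotient map it compares the
equivalence relations before and after a crossing has been absorbed into the labels. -/
theorem relabel_eq_imp_iff {V α : Type} (lab : V → ℕ) (x y : V) (Q : V → α) :
    (∀ z w, relabel (lab x) (lab y) (lab z) = relabel (lab x) (lab y) (lab w) → Q z = Q w) ↔
      Q x = Q y ∧ ∀ z w, lab z = lab w → Q z = Q w := by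
  simp only [relabel_eq]
  constructor
  · intro h
    exact ⟨h _ _ (by simp), fun z w e => h _ _ (by rw [e])⟩
  · rintro ⟨h1, h2⟩ z w
    have := h2 z x
    have := h2 w x
    have := h2 z w
    have := h2 y w
    have := h2 z y
    grind

open VertexCrossing in
-- The two edges of the smoothed first crossing can be contracted by merging labels: both relations
-- generate the same equivalence relation.
theorem card_quot_adj_cons {V : Type} {k : ℕ} (lab : V → ℕ) (c : Fin (k + 1) → VertexCrossing V)
    (b : Bool) (s : Fin k → Bool) (lab' lab'' : V → ℕ)
    (h' : ∀ z, lab' z = relabel (lab (c 0).underIn) (lab ((c 0).firstEnd b)) (lab z))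
    (h'' : ∀ z, lab'' z = relabel (lab' (c 0).underOut) (lab' ((c 0).secondEnd b)) (lab' z)) :
    Nat.card (Quot (Adj lab c (Fin.cons b s))) =
      Nat.card (Quot (Adj lab'' (fun i => c i.succ) s)) := by
  have key' {α : Type} (Q : V → α) :=
    relabel_eq_imp_iff lab (c 0).underIn ((c 0).firstEnd b) Q
  have key'' {α : Type} (Q : V → α) :=
    relabel_eq_imp_iff lab' (c 0).underOut ((c 0).secondEnd b) Q
  simp only [← h', ← h''] at key' key''
  refine Nat.card_quot_congr id id ?_ ?_ (fun _ => rfl) (fun _ => rfl)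
  · have h := (key'' (Quot.mk (Adj lab'' (fun i => c i.succ) s))).1
      (fun z w e => Quot.sound (Or.inl e))
    have h' := (key' _).1 h.2
    rintro x y (e | ⟨i, e⟩)
    · exact h'.2 x y e
    · induction i using Fin.cases with
      | zero =>
        rcases e with ⟨rfl, rfl⟩ | ⟨rfl, rfl⟩
        · exact h'.1
        · exact h.1
      | succ i => exact Quot.sound (Or.inr ⟨i, by simpa using e⟩)
  · rintro x y (e | ⟨i, e⟩)
    · refine (key'' (Quot.mk (Adj lab c (Fin.cons b s)))).2
        ⟨Quot.sound (Or.inr ⟨0, Or.inr (by simp)⟩), ?_⟩ x y e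
      exact (key' _).2
        ⟨Quot.sound (Or.inr ⟨0, Or.inl (by simp)⟩), fun z w e => Quot.sound (Or.inl e)⟩
    · exact Quot.sound (Or.inr ⟨i.succ, by simpa using e⟩)

theorem card_quot_adj_zero {V : Type} (lab : V → ℕ) (c : Fin 0 → VertexCrossing V)
    (s : Fin 0 → Bool) :
    Nat.card (Quot (VertexCrossing.Adj lab c s)) = (Set.range lab).ncard := by
  rw [← Nat.card_coe_set_eq]
  refine Nat.card_congr (Equiv.ofBijective
    (Quot.lift (Set.rangeFactorization lab) fun x y h => Subtype.ext ?_) ⟨?_, ?_⟩)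
  · exact h.resolve_right fun ⟨i, _⟩ => i.elim0
  · rintro ⟨x⟩ ⟨y⟩ h
    exact Quot.sound (Or.inl (congrArg Subtype.val h))
  · rintro ⟨_, x, rfl⟩
    exact ⟨Quot.mk _ x, rfl⟩

/-- Correctness of the algorithm, by induction on the crossings. The labelling has to be arbitrary
because each smoothing merges labels; merging never increases their number, so the bound by `M + 1`
persists. -/
theorem evalCoeffs_stateCoeffs {q : ℝ} (hq : q ≠ 0) {V : Type} [Finite V] {M k : ℕ} (lab : V → ℕ)
    (hM : (Set.range lab).ncard ≤ M + 1) (c : Fin k → VertexCrossing V) :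
    evalCoeffs q (stateCoeffs M k (List.ofFn fun i => (c i).map lab) (Set.range lab).ncard) =
      q ^ M * ∑ s : Fin k → Bool, (∏ i, normWeight q (c i).positive (s i)) *
        (q + q⁻¹) ^ (Nat.card (Quot (VertexCrossing.Adj lab c s)) - 1) := by
  induction k generalizing lab with
  | zero =>
    simp only [stateCoeffs, card_quot_adj_zero]
    -- This is where `hM` matters: the loop exponent must not exceed `M`, or the padding with zeros
    -- would be truncated.
    rw [evalCoeffs_loopCoeffs hq (by omega)]
    simp
  | succ k ih =>
    let lab' (b : Bool) (z : V) := relabel (lab (c 0).underIn) (lab ((c 0).firstEnd b)) (lab z)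
    let lab'' (b : Bool) (z : V) :=
      relabel (lab' b (c 0).underOut) (lab' b ((c 0).secondEnd b)) (lab' b z)
    have hc (b : Bool) : (Set.range (lab'' b)).ncard = joinCount (lab' b (c 0).underOut)
        (lab' b ((c 0).secondEnd b)) (joinCount (lab (c 0).underIn) (lab ((c 0).firstEnd b))
          (Set.range lab).ncard) := by
      rw [joinCount_card_range, joinCount_card_range]
    have hM' (b : Bool) : (Set.range (lab'' b)).ncard ≤ M + 1 := by
      have (x y n : ℕ) : joinCount x y n ≤ n := by
        rw [joinCount]
        cases Nat.beq x y <;> simp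
      exact (hc b).trans_le ((this _ _ _).trans ((this _ _ _).trans hM))
    have ih (b : Bool) := ih (lab'' b) (hM' b) (fun i => c i.succ)
    simp only [hc] at ih
    have h1 (b : Bool) : ((c 0).map lab).firstEnd b = lab ((c 0).firstEnd b) := by
      cases b <;> rfl
    have h2 (b : Bool) : ((c 0).map lab).secondEnd b = lab ((c 0).secondEnd b) := by
      cases b <;> rfl
    have hcard (b : Bool) (s : Fin k → Bool) := card_quot_adj_cons lab c b s (lab' b) (lab'' b)
      (fun _ => rfl) (fun _ => rfl)
    rw [← (Fin.consEquiv fun _ => Bool).sum_comp, Fintype.sum_prod_type]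
    simp only [Fin.consEquiv, Equiv.coe_fn_mk, Fintype.sum_bool, Fin.prod_univ_succ, Fin.cons_zero,
      Fin.cons_succ, hcard, List.ofFn_succ, stateCoeffs, mul_assoc, h1, h2, List.map_ofFn,
      ← Finset.mul_sum, evalCoeffs_addCoeffs]
    rw [mul_add, mul_left_comm, mul_left_comm (q ^ M) (normWeight q (c 0).positive false),
      ← ih, ← ih]
    cases h : (c 0).positive <;>
      simp [evalCoeffs, evalCoeffs_neg, normWeight, VertexCrossing.map, h, lab', Function.comp_def]
    all_goals ring

namespace KT2

/-- The ten crossings outside the clasp, if the vertices `x`, `y`, `z` and `w` are the arcs at the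
top left, top right, bottom left and bottom right end of the clasp. -/
def outer (x y z w : Fin 20) : Fin 10 → VertexCrossing (Fin 20) :=
  ![⟨true, 17, x, 12, 13⟩, ⟨true, 11, 12, 16, 17⟩, ⟨true, 15, 16, 10, 11⟩,
    ⟨false, z, 0, 13, 14⟩, ⟨false, 14, 15, 0, 1⟩, ⟨true, 2, w, 6, 7⟩, ⟨true, 5, 6, 1, 2⟩,
    ⟨false, y, 3, 7, 8⟩, ⟨false, 8, 9, 3, 4⟩, ⟨false, 4, 5, 9, 10⟩]

end KT2

/-! ### The Jones polynomial as a state sum at a real number. -/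

theorem laurentFun_eq_eval₂ (V : ℤ[T;T⁻¹]) (u : ℝˣ) :
    laurentFun V u = eval₂ (Int.castRingHom ℝ) u V := by
  induction V using LaurentPolynomial.induction_on' with
  | add p p' hp hp' =>
    rw [map_add, ← hp, ← hp']
    simp only [laurentFun, AddMonoidAlgebra.coeff_add]
    exact Finsupp.sum_add_index' (by simp) (by intros; push_cast; ring)
  | C_mul_T n a =>
    rw [eval₂_C_mul_T, laurentFun, ← single_eq_C_mul_T]
    simp [-single_eq_C_mul_T]

/-- The weight of a smoothing at a crossing, at `q`. -/
noncomputable def realWeight (q : ℝ) : Bool → Bool → ℝ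
  | true, true => q
  | true, false => -q ^ 2
  | false, true => q⁻¹
  | false, false => -(q ^ 2)⁻¹

theorem laurentFun_jones (D : LinkDiagram) {q : ℝ} (hq : q ≠ 0) :
    laurentFun D.jones q = ∑ s : D.Crossing → Bool,
      (∏ c, realWeight q (D.positive c) (s c)) * (q + q⁻¹) ^ (D.loops s - 1) := by
  have hw (s : D.Crossing → Bool) (c : D.Crossing) :
      eval₂ (Int.castRingHom ℝ) (Units.mk0 q hq) (D.weight s c) =
        realWeight q (D.positive c) (s c) := by
    cases h : D.positive c <;> cases h' : s c <;>
      simp [OrientedCode.weight, h, h', realWeight, eval₂_T, zpow_ofNat]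
  have := laurentFun_eq_eval₂ D.jones (Units.mk0 q hq)
  rw [Units.val_mk0] at this
  rw [this, LinkDiagram.jones]
  simp [hw, eval₂_T]

/-! ### Columns of crossings. -/

/-- The sum over the states of a column of `N` crossings. -/
theorem sum_column {N : ℕ} (w : Bool → ℝ) {d : ℝ} (hd : w true * d + w false = 1) (x y : ℝ) :
    d * ∑ s : Fin N → Bool, (∏ j, w (s j)) *
      (if ∀ j, s j = false then x else y * d ^ ((Finset.univ.filter fun j => s j = true).card - 1)) =
    w false ^ N * (d * x) + (1 - w false ^ N) * y := by
  -- If each `true` contributed a full factor `d`, the sum would be the expansion of `(w true * d +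
  -- w false) ^ N`. Only the all-`false` state is counted differently, so it is split off.
  have h1 : ∑ s : Fin N → Bool, (∏ j, w (s j)) * d ^ (Finset.univ.filter fun j => s j = true).card = 1 := by
    have : ∏ j : Fin N, ∑ b : Bool, (w b * if b = true then d else 1) = 1 := by
      simp [hd]
    rw [Fintype.prod_sum] at this
    rw [← this]
    refine Finset.sum_congr rfl fun s _ => ?_
    rw [Finset.prod_mul_distrib, Finset.prod_ite]
    simp
  have h0 : ∀ F : (Fin N → Bool) → ℝ, ∑ s, F s = F (fun _ => false) +
      ∑ s ∈ Finset.univ.erase (fun _ => false), F s := fun F =>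
    (Finset.add_sum_erase _ F (Finset.mem_univ _)).symm
  rw [h0] at h1 ⊢
  simp only [Finset.prod_const, Finset.card_univ, Fintype.card_fin, reduceCtorEq,
    Finset.filter_false, Finset.card_empty, pow_zero, mul_one] at h1
  have h2 : ∀ s ∈ Finset.univ.erase (fun _ : Fin N => false), d * ((∏ j, w (s j)) *
      (if ∀ j, s j = false then x else y * d ^ ((Finset.univ.filter fun j => s j = true).card - 1))) =
      y * ((∏ j, w (s j)) * d ^ (Finset.univ.filter fun j => s j = true).card) := by
    intro s hs
    have hs : ¬ ∀ j, s j = false := fun h => (Finset.mem_erase.1 hs).1 (funext h)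
    rw [if_neg hs]
    -- The factor `d` in front restores the exponent lowered by one; this needs a `true`, since the
    -- subtraction is truncated.
    have hc : (Finset.univ.filter fun j => s j = true).card ≠ 0 := by
      simpa using hs
    obtain ⟨k, hk⟩ := Nat.exists_eq_succ_of_ne_zero hc
    rw [hk, Nat.succ_sub_one, pow_succ]
    ring
  rw [mul_add, Finset.mul_sum, Finset.sum_congr rfl h2, ← Finset.mul_sum,
    eq_sub_of_add_eq' h1]
  simp
  ring

namespace Ladder

variable {N : ℕ} (s : Fin N → Bool)

/-- The number of horizontal smoothings above level `j`. -/
def height (j : Fin (N + 1)) : ℕ := (Finset.univ.filter fun i : Fin N => i.val < j.val ∧ s i = true).card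

theorem height_zero : height s 0 = 0 := by simp [height]

theorem height_last : height s (Fin.last N) = (Finset.univ.filter fun i => s i = true).card := by
  simp [height]

theorem height_succ (j : Fin N) :
    height s j.succ = height s j.castSucc + if s j = true then 1 else 0 := by
  have : (Finset.univ.filter fun i : Fin N => i.val < j.succ.val ∧ s i = true) =
      (Finset.univ.filter fun i : Fin N => i.val < j.castSucc.val ∧ s i = true) ∪
      if s j = true then {j} else ∅ := by
    ext i
    by_cases h : s j = true <;> simp [h, Fin.ext_iff] <;> grind [Fin.ext_iff]
  rw [height, this, Finset.card_union_of_disjoint, height]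
  · split_ifs <;> simp
  · split_ifs <;> simp

theorem height_mono : Monotone (height s) :=
  fun _ _ h => Finset.card_le_card fun i hi => by
    simp only [Finset.mem_filter] at hi ⊢
    exact ⟨hi.1, hi.2.1.trans_le h, hi.2.2⟩

theorem exists_height_eq {m : ℕ} (hm : m ≤ height s (Fin.last N)) : ∃ j, height s j = m := by
  have (j : Fin (N + 1)) : ∀ m ≤ height s j, ∃ i, height s i = m := by
    induction j using Fin.induction with
    | zero => intro m hm; exact ⟨0, by rw [height_zero] at *; omega⟩
    | succ j ih =>
      intro m hm
      rcases hm.eq_or_lt with rfl | hm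
      · exact ⟨_, rfl⟩
      · refine ih m ?_
        rw [height_succ] at hm
        split_ifs at hm <;> omega
  exact this _ m hm

/-- A horizontal smoothing makes the two sides agree at the levels next to it, and a vertical one
passes the agreement on. It spreads downwards to all levels below a horizontal smoothing (`h1`) and
upwards to all levels above one (`h2`). -/
theorem sides_eq {α : Type*} {s : Fin N → Bool} {A B : Fin (N + 1) → α}
    (ht : ∀ j, s j = true → A j.castSucc = B j.castSucc ∧ A j.succ = B j.succ)
    (hf : ∀ j, s j = false → A j.castSucc = B j.succ ∧ A j.succ = B j.castSucc)
    (h : ∃ j, s j = true) (j : Fin (N + 1)) : A j = B j := by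
  have h1 : ∀ j, 0 < height s j → A j = B j := by
    intro j
    induction j using Fin.induction with
    | zero => simp [height_zero]
    | succ j ih =>
      intro hj
      rw [height_succ] at hj
      cases h : s j
      · rw [(hf j h).2, ← (hf j h).1, ih (by simpa [h] using hj)]
      · exact (ht j h).2
  have h2 : ∀ j, height s j < height s (Fin.last N) → A j = B j := by
    intro j
    induction j using Fin.reverseInduction with
    | last => simp
    | cast j ih =>
      intro hj
      cases h : s j
      · rw [(hf j h).1, ← (hf j h).2, ih (by simpa [height_succ, h] using hj)]
      · exact (ht j h).1
  have h3 : 0 < height s (Fin.last N) := by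
    rw [height_last, Finset.card_pos]
    exact h.imp fun j hj => by simpa using hj
  by_cases hj : 0 < height s j
  · exact h1 j hj
  · exact h2 j (by omega)

/-- Between levels of equal height all smoothings are vertical. These exchange the names `A` and `B`
of the sides, which is harmless by `sides_eq`. -/
theorem levels_eq {α : Type*} {s : Fin N → Bool} {A B : Fin (N + 1) → α}
    (ht : ∀ j, s j = true → A j.castSucc = B j.castSucc ∧ A j.succ = B j.succ)
    (hf : ∀ j, s j = false → A j.castSucc = B j.succ ∧ A j.succ = B j.castSucc)
    (h : ∃ j, s j = true) {i j : Fin (N + 1)} (hij : height s i = height s j) :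
    A i = A j := by
  have key : ∀ j, ∀ i ≤ j, height s i = height s j → A i = A j := by
    intro j
    induction j using Fin.induction with
    | zero => intro i hi _; rw [Fin.le_zero_iff.1 hi]
    | succ j ih =>
      intro i hi hij
      rcases hi.eq_or_lt with rfl | hi
      · rfl
      · have hi : i ≤ j.castSucc := Fin.le_castSucc_iff.2 hi
        have h1 := height_mono s hi
        have h2 := height_succ s j
        cases hs : s j
        · rw [ih i hi (by simp [hs] at h2; omega), sides_eq ht hf h, ← (hf j hs).2]
        · simp [hs] at h2; omega
  rcases le_total i j with h | h
  · exact key j i h hij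
  · exact (key i j h hij.symm).symm

theorem sides_alternate {α : Type*} {s : Fin N → Bool} {A B : Fin (N + 1) → α}
    (hf : ∀ j, s j = false → A j.castSucc = B j.succ ∧ A j.succ = B j.castSucc)
    (h : ∀ j, s j = false) (j : Fin (N + 1)) :
    A j = (if j.val % 2 = 0 then A 0 else B 0) ∧ B j = if j.val % 2 = 0 then B 0 else A 0 := by
  induction j using Fin.induction with
  | zero => simp
  | succ j ih =>
    rw [(hf j (h j)).2, ← (hf j (h j)).1, ih.1, ih.2]
    rw [Fin.val_castSucc, Fin.val_succ]
    by_cases hj : j.val % 2 = 0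
    · simp [hj, show (j.val + 1) % 2 ≠ 0 by omega]
    · simp [hj, show (j.val + 1) % 2 = 0 by omega]

end Ladder

/-- The relation never links an element of `W` to anything else after contraction by `f`, so each
one is a class of its own: a free circle of the clasp in the application. -/
theorem card_quot_sum {V W X : Type} [Finite V] [Finite W] {r : V → V → Prop} {r' : X → X → Prop}
    (f : X → V ⊕ W) (g : V ⊕ W → X)
    (hf : ∀ x y, r' x y → f x = f y ∨ ∃ u v, f x = .inl u ∧ f y = .inl v ∧ Quot.mk r u = Quot.mk r v)
    (hg : ∀ u v, r u v → Quot.mk r' (g (.inl u)) = Quot.mk r' (g (.inl v)))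
    (hgf : ∀ x, Quot.mk r' (g (f x)) = Quot.mk r' x) (hfg : ∀ y, f (g y) = y) :
    Nat.card (Quot r') = Nat.card (Quot r) + Nat.card W := by
  rw [← Nat.card_sum]
  refine Nat.card_congr
    { toFun := Quot.lift (fun x => Sum.map (Quot.mk r) id (f x)) ?_
      invFun := Sum.elim (Quot.lift (fun u => Quot.mk r' (g (.inl u))) hg)
        (fun w => Quot.mk r' (g (.inr w)))
      left_inv := ?_
      right_inv := ?_ }
  · rintro x y h
    rcases hf x y h with h | ⟨u, v, hu, hv, h⟩
    · rw [h]
    · simp [hu, hv, h]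
  · rintro ⟨x⟩
    have := hgf x
    rcases h : f x with u | w <;> simpa [h] using this
  · rintro (⟨⟨u⟩⟩ | w) <;> simp [hfg]

namespace KT2

open VertexCrossing

/-- The curve of the smoothed diagram that contains the arc `e`. -/
def curve {n : ℤ} (s : Cr n → Bool) (e : Ar n) : Quot ((code n).Joined s) := Quot.mk _ e

theorem joined_clasp (n : ℤ) (s : Cr n → Bool) (j : Fin (2 * n.natAbs)) :
    (s (.inr j) = true →
      curve s (a j.castSucc) = curve s (b j.castSucc) ∧
      curve s (a j.succ) = curve s (b j.succ)) ∧
    (s (.inr j) = false →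
      curve s (a j.castSucc) = curve s (b j.succ) ∧
      curve s (a j.succ) = curve s (b j.castSucc)) := by
  constructor <;> intro h
  · have h1 := Quot.sound (OrientedCode.Joined.along₁ (D := code n) (.inr j) h)
    have h2 := Quot.sound (OrientedCode.Joined.along₂ (D := code n) (.inr j) h)
    by_cases hj : aOver n j <;>
      simp only [code, underIn, underOut, overIn, overOut, hj, if_true, if_false,
        Bool.false_eq_true] at h1 h2
    · exact ⟨h2, h1.symm⟩
    · exact ⟨h1, h2.symm⟩
  · have h1 := Quot.sound (OrientedCode.Joined.against₁ (D := code n) (.inr j) h)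
    have h2 := Quot.sound (OrientedCode.Joined.against₂ (D := code n) (.inr j) h)
    by_cases hj : aOver n j <;>
      simp only [code, underIn, underOut, overIn, overOut, hj, if_true, if_false,
        Bool.false_eq_true] at h1 h2
    · exact ⟨h1.symm, h2.symm⟩
    · exact ⟨h1, h2⟩

/-- A map that closes up the ends of the clasp takes the crossings outside it to `outer`. -/
theorem outer_arcs {n : ℤ} {W : Type} (f : Ar n → Fin 20 ⊕ W) {x y z w : Fin 20}
    (ho : ∀ i : Fin 18, f (o i) = .inl ⟨i, by omega⟩) (hx : f (a 0) = .inl x) (hy : f (b 0) = .inl y)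
    (hz : f (a (Fin.last _)) = .inl z) (hw : f (b (Fin.last _)) = .inl w) (i : Fin 10) :
    f (underIn n (.inl i)) = .inl (outer x y z w i).underIn ∧
    f (underOut n (.inl i)) = .inl (outer x y z w i).underOut ∧
    f (overIn n (.inl i)) = .inl (outer x y z w i).overIn ∧
    f (overOut n (.inl i)) = .inl (outer x y z w i).overOut := by
  fin_cases i <;> simp [underIn, underOut, overIn, overOut, outer, ho, hx, hy, hz, hw]

/-- By `ht` and `hf` the map `f` contracts every edge of the smoothed clasp, and by `hgf` it
identifies only arcs on the same curve. What remains are the ten outer crossings and the circles in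
`W`. -/
theorem card_joined {n : ℤ} {W : Type} [Finite W] (s : Cr n → Bool) (f : Ar n → Fin 20 ⊕ W)
    (g : Fin 20 ⊕ W → Ar n) {x y z w : Fin 20}
    (ho : ∀ i : Fin 18, f (o i) = .inl ⟨i, by omega⟩) (hx : f (a 0) = .inl x) (hy : f (b 0) = .inl y)
    (hz : f (a (Fin.last _)) = .inl z) (hw : f (b (Fin.last _)) = .inl w)
    (ht : ∀ j, s (.inr j) = true → f (a j.castSucc) = f (b j.castSucc) ∧ f (a j.succ) = f (b j.succ))
    (hf : ∀ j, s (.inr j) = false → f (a j.castSucc) = f (b j.succ) ∧ f (a j.succ) = f (b j.castSucc))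
    (hgf : ∀ x, curve s (g (f x)) = curve s x) (hfg : ∀ y, f (g y) = y) :
    (code n).loops s = Nat.card (Quot (Adj Fin.val (outer x y z w) fun i => s (.inl i))) +
      Nat.card W := by
  have hv (i : Fin 10) := outer_arcs f ho hx hy hz hw i
  refine card_quot_sum f g ?_ ?_ hgf hfg
  · rintro e e' h
    have hi (i : Fin 10) (b : Bool) (h : s (.inl i) = b) :
        Adj Fin.val (outer x y z w) (fun i => s (.inl i)) (outer x y z w i).underIn
          ((outer x y z w i).firstEnd b) ∧
        Adj Fin.val (outer x y z w) (fun i => s (.inl i)) (outer x y z w i).underOut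
          ((outer x y z w i).secondEnd b) :=
      ⟨.inr ⟨i, .inl ⟨rfl, by simp only [h]⟩⟩, .inr ⟨i, .inr ⟨rfl, by simp only [h]⟩⟩⟩
    rcases h with ⟨c, h⟩ | ⟨c, h⟩ | ⟨c, h⟩ | ⟨c, h⟩ <;> rcases c with i | j
    · exact .inr ⟨_, _, (hv i).1, (hv i).2.2.2, Quot.sound (hi i _ h).1⟩
    · left
      by_cases hj : aOver n j <;> simp only [code, underIn, overOut, hj, if_true, if_false,
        Bool.false_eq_true, ht j h]
    · exact .inr ⟨_, _, (hv i).2.2.1, (hv i).2.1, (Quot.sound (hi i _ h).2).symm⟩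
    · left
      by_cases hj : aOver n j <;> simp only [code, overIn, underOut, hj, if_true, if_false,
        Bool.false_eq_true, ht j h]
    · exact .inr ⟨_, _, (hv i).1, (hv i).2.2.1, Quot.sound (hi i _ h).1⟩
    · left
      by_cases hj : aOver n j <;> simp only [code, underIn, overIn, hj, if_true, if_false,
        Bool.false_eq_true, hf j h]
    · exact .inr ⟨_, _, (hv i).2.1, (hv i).2.2.2, Quot.sound (hi i _ h).2⟩
    · left
      by_cases hj : aOver n j <;> simp only [code, underOut, overOut, hj, if_true, if_false,
        Bool.false_eq_true, hf j h]
  · rintro u v (h | ⟨i, ⟨rfl, rfl⟩ | ⟨rfl, rfl⟩⟩)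
    · rw [Fin.ext h]
    · change curve s (g _) = curve s (g (.inl ((outer x y z w i).firstEnd (s (.inl i)))))
      rw [← (hv i).1, hgf]
      cases h : s (.inl i)
      · rw [firstEnd, cond_false, ← (hv i).2.2.1, hgf]
        exact Quot.sound (OrientedCode.Joined.against₁ (D := code n) (.inl i) h)
      · rw [firstEnd, cond_true, ← (hv i).2.2.2, hgf]
        exact Quot.sound (OrientedCode.Joined.along₁ (D := code n) (.inl i) h)
    · change curve s (g _) = curve s (g (.inl ((outer x y z w i).secondEnd (s (.inl i)))))
      rw [← (hv i).2.1, hgf]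
      cases h : s (.inl i)
      · rw [secondEnd, cond_false, ← (hv i).2.2.2, hgf]
        exact Quot.sound (OrientedCode.Joined.against₂ (D := code n) (.inl i) h)
      · rw [secondEnd, cond_true, ← (hv i).2.2.1, hgf]
        exact (Quot.sound (OrientedCode.Joined.along₂ (D := code n) (.inl i) h)).symm

/-- Strands `a` and `b` change sides at each crossing. Their number is even, so the left vertical
strand `18` joins the two ends of `a` and the right one, `19`, those of `b`. -/
theorem loops_of_forall {n : ℤ} (s : Cr n → Bool) (h : ∀ j, s (.inr j) = false) :
    (code n).loops s = Nat.card (Quot (Adj Fin.val (outer 18 19 18 19) fun i => s (.inl i))) := by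
  have hl : 2 * n.natAbs % 2 = 0 := by omega
  let f : Ar n → Fin 20 ⊕ Empty
    | .inl i => .inl ⟨i, by omega⟩
    | .inr (.inl j) => .inl (if j.val % 2 = 0 then 18 else 19)
    | .inr (.inr j) => .inl (if j.val % 2 = 0 then 19 else 18)
  let g : Fin 20 ⊕ Empty → Ar n
    | .inl i => if hi : i.val < 18 then o ⟨i, hi⟩ else if i = 18 then a 0 else b 0
  have halt := Ladder.sides_alternate (s := fun j => s (.inr j))
    (A := fun j => curve s (a j)) (B := fun j => curve s (b j))
    (fun j => (joined_clasp n s j).2) h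
  have hj (j : Fin (2 * n.natAbs)) : j.succ.val % 2 = 0 ↔ ¬ j.castSucc.val % 2 = 0 := by
    rw [Fin.val_castSucc, Fin.val_succ]; omega
  have := card_joined s f g (x := 18) (y := 19) (z := 18) (w := 19) (fun _ => rfl) (by simp [f])
    (by simp [f]) (by simp [f, hl]) (by simp [f, hl]) (by simp [h])
    (fun j _ => by simp only [f, hj]; split_ifs <;> simp) ?_ ?_
  · simpa using this
  · rintro (i | j | j)
    · simp [f, g]
    · rw [(halt j).1]
      by_cases hj : j.val % 2 = 0 <;> simp [f, g, hj]
    · rw [(halt j).2]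
      by_cases hj : j.val % 2 = 0 <;> simp [f, g, hj]
  · rintro (i | i)
    · fin_cases i <;> simp [f, g]
    · exact i.elim

theorem loops_of_exists {n : ℤ} (s : Cr n → Bool) (h : ∃ j, s (.inr j) = true) :
    (code n).loops s = Nat.card (Quot (Adj Fin.val (outer 18 18 19 19) fun i => s (.inl i))) +
      ((Finset.univ.filter fun j => s (.inr j) = true).card - 1) := by
  set k := (Finset.univ.filter fun j => s (.inr j) = true).card with hk
  let s' : Fin (2 * n.natAbs) → Bool := fun j => s (.inr j)
  have hlast : Ladder.height s' (Fin.last _) = k := Ladder.height_last s'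
  have hpos : 0 < k := by
    rw [hk, Finset.card_pos]
    exact h.imp fun j hj => by simpa using hj
  -- The curve through the levels of height `m`: the cap `18` for `m = 0`, the cup `19` for `m = k`,
  -- and the circle number `m - 1` in between.
  let level (m : ℕ) : Fin 20 ⊕ Fin (k - 1) :=
    if m = 0 then .inl 18 else if hm : m - 1 < k - 1 then .inr ⟨m - 1, hm⟩ else .inl 19
  have hex (m : Fin (k - 1)) : ∃ j, Ladder.height s' j = m + 1 :=
    Ladder.exists_height_eq s' (by omega)
  choose c hc using hex
  let f : Ar n → Fin 20 ⊕ Fin (k - 1)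
    | .inl i => .inl ⟨i, by omega⟩
    | .inr (.inl j) => level (Ladder.height s' j)
    | .inr (.inr j) => level (Ladder.height s' j)
  let g : Fin 20 ⊕ Fin (k - 1) → Ar n
    | .inl i => if hi : i.val < 18 then o ⟨i, hi⟩ else if i = 18 then a 0 else a (Fin.last _)
    | .inr m => a (c m)
  have ht := fun j => (joined_clasp n s j).1
  have hf := fun j => (joined_clasp n s j).2
  have hsides := Ladder.sides_eq (s := s') (A := fun j => curve s (a j))
    (B := fun j => curve s (b j)) ht hf h
  have hlevels {i j : Fin (2 * n.natAbs + 1)} := Ladder.levels_eq (s := s')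
    (A := fun j => curve s (a j)) (B := fun j => curve s (b j)) ht hf h
    (i := i) (j := j)
  have l0 : level 0 = .inl 18 := by simp [level]
  have lk : level k = .inl 19 := by simp [level, hpos.ne']
  have hga (j : Fin (2 * n.natAbs + 1)) :
      curve s (g (level (Ladder.height s' j))) = curve s (a j) := by
    have hle : Ladder.height s' j ≤ k := hlast ▸ Ladder.height_mono s' (Fin.le_last j)
    by_cases h0 : Ladder.height s' j = 0
    · rw [h0, l0]
      exact hlevels ((Ladder.height_zero s').trans h0.symm)
    by_cases h1 : Ladder.height s' j = k
    · rw [h1, lk]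
      exact hlevels (hlast.trans h1.symm)
    · have hm : Ladder.height s' j - 1 < k - 1 := by omega
      simp only [level, h0, hm, if_false, dif_pos]
      exact hlevels ((hc _).trans (by simp only; omega))
  have := card_joined s f g (x := 18) (y := 18) (z := 19) (w := 19) (fun _ => rfl)
    (by simp only [f, Ladder.height_zero, l0]) (by simp only [f, Ladder.height_zero, l0])
    (by simp only [f, hlast, lk]) (by simp only [f, hlast, lk]) (fun j _ => ⟨rfl, rfl⟩)
    (fun j hj => by
      have : Ladder.height s' j.succ = Ladder.height s' j.castSucc := by
        simp [Ladder.height_succ, s', hj]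
      simp [f, this]) ?_ ?_
  · simpa using this
  · rintro (i | j | j)
    · simp [f, g]
    · exact hga j
    · exact (hga j).trans (hsides j)
  · rintro (i | m)
    · have h18 (i : Fin 18) : f (o i) = .inl ⟨i, by omega⟩ := rfl
      have ha0 : f (a 0) = .inl 18 := by simp only [f, Ladder.height_zero, l0]
      have hal : f (a (Fin.last _)) = .inl 19 := by simp only [f, hlast, lk]
      by_cases hi : i.val < 18
      · simp [g, hi, h18]
      · by_cases hi' : i = 18
        · simp [g, hi', ha0]
        · simp only [g, hi, hi', dif_neg, if_false, not_false_eq_true, hal]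
          congr 1
          ext
          have : i.val ≠ 18 := fun e => hi' (Fin.ext e)
          change 19 = i.val
          omega
    · simp [f, g, hc, level]

end KT2

/-! ### The two closures and the Jones polynomial of `KT_{2,n}`. -/

namespace KT2

open VertexCrossing

/-- There are 20 vertices, so no loop exponent exceeds 19. The 29 leading zeros are pure
normalisation: `q ^ 19` for the loops and `q ^ 2` for each of five negative crossings. -/
theorem stateCoeffs_unknot :
    stateCoeffs 19 10 (List.ofFn fun i => (outer 18 19 18 19 i).map Fin.val) 20 =
      List.replicate 29 0 ++ 1 :: List.replicate 8 0 := by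
  decide +kernel

theorem stateCoeffs_pretzel :
    stateCoeffs 19 10 (List.ofFn fun i => (outer 18 18 19 19 i).map Fin.val) 20 =
      List.replicate 20 0 ++
        [-1, 0, 1, 0, -1, 0, 1, 0, 1, 0, 1, 0, 1, 0, -1, 0, 1, 0, -1] := by
  decide +kernel

/-- The state sum of the diagram obtained by closing up the ends of the clasp. -/
noncomputable def outerSum (q : ℝ) (x y z w : Fin 20) : ℝ :=
  ∑ s : Fin 10 → Bool, (∏ i, realWeight q (positive 0 (.inl i)) (s i)) *
    (q + q⁻¹) ^ (Nat.card (Quot (Adj Fin.val (outer x y z w) s)) - 1)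

theorem outerSum_eq {q : ℝ} (hq : q ≠ 0) (x y z w : Fin 20) :
    q ^ 29 * outerSum q x y z w =
      evalCoeffs q (stateCoeffs 19 10 (List.ofFn fun i => (outer x y z w i).map Fin.val) 20) := by
  have h20 : (Set.range (Fin.val : Fin 20 → ℕ)).ncard = 20 := by
    rw [← Set.image_univ, Set.ncard_image_of_injective _ Fin.val_injective]
    simp
  have := evalCoeffs_stateCoeffs hq (M := 19) (Fin.val : Fin 20 → ℕ) h20.le (outer x y z w)
  rw [h20] at this
  rw [this, show (29 : ℕ) = 19 + 10 from rfl, pow_add, mul_assoc, outerSum, Finset.mul_sum]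
  congr 1
  refine Finset.sum_congr rfl fun s _ => ?_
  rw [← mul_assoc]
  congr 1
  have hw (b : Bool) : realWeight q true b = normWeight q true b ∧
      realWeight q false b = (q ^ 2)⁻¹ * normWeight q false b := by
    cases b
    · simp [realWeight, normWeight]
    · simp only [realWeight, normWeight, true_and]
      field_simp
  simp only [Fin.prod_univ_succ, positive, outer]
  simp [hw]
  field_simp

theorem outerSum_unknot {q : ℝ} (hq : q ≠ 0) : outerSum q 18 19 18 19 = 1 := by
  have h := outerSum_eq hq 18 19 18 19
  rw [stateCoeffs_unknot, evalCoeffs_replicate_append] at h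
  simpa [evalCoeffs, List.replicate, hq] using h

/-- `1` minus the Jones polynomial of `P(3, -2, 2, -3)` over the one of the unlink. -/
noncomputable def pretzelDefect (q : ℝ) : ℝ :=
  (1 - q ^ 2) ^ 2 * (1 + q ^ 4) * (1 + q ^ 4 + q ^ 8) * (q ^ 8)⁻¹

theorem outerSum_pretzel {q : ℝ} (hq : q ≠ 0) :
    outerSum q 18 18 19 19 = (q + q⁻¹) * (1 - pretzelDefect q) := by
  have h := outerSum_eq hq 18 18 19 19
  rw [stateCoeffs_pretzel, evalCoeffs_replicate_append] at h
  refine mul_left_cancel₀ (pow_ne_zero 29 hq) (h.trans ?_)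
  simp [evalCoeffs, pretzelDefect]
  field_simp
  ring

theorem laurentFun_jones_KT2 (n : ℤ) {q : ℝ} (hq : 0 < q) :
    laurentFun (KT2 n).jones q = 1 + (q ^ (4 * n) - 1) * pretzelDefect q := by
  have hd : q + q⁻¹ ≠ 0 := by positivity
  have h1 : laurentFun (KT2 n).jones q = ∑ s : Cr n → Bool,
      (∏ c, realWeight q (positive n c) (s c)) * (q + q⁻¹) ^ ((code n).loops s - 1) :=
    laurentFun_jones (KT2 n) hq.ne'
  let w := realWeight q (decide (0 < n))
  -- Invariance of the state sum under the removal of a kink, for either sign.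
  have hw : w true * (q + q⁻¹) + w false = 1 := by
    by_cases hn : 0 < n <;> simp [w, hn, realWeight] <;> field_simp <;> ring
  -- The sign of `-q ^ (±2)` disappears in the even power, and the sign of the crossings turns `|n|`
  -- into `n`.
  have hwn : w false ^ (2 * n.natAbs) = q ^ (4 * n) := by
    rw [pow_mul]
    by_cases hn : 0 < n
    · obtain ⟨m, rfl⟩ := Int.eq_ofNat_of_zero_le hn.le
      have hm : 0 < m := by exact_mod_cast hn
      simp only [w, hn, decide_true, realWeight, Int.natAbs_natCast]
      rw [neg_sq, ← pow_mul, ← pow_mul, ← zpow_natCast]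
      push_cast
      ring_nf
    · obtain ⟨m, rfl⟩ := Int.eq_ofNat_of_zero_le (neg_nonneg.2 (not_lt.1 hn)) |>.imp
        fun m hm => neg_eq_iff_eq_neg.1 hm
      simp only [w, hn, decide_false, realWeight, Int.natAbs_neg, Int.natAbs_natCast]
      rw [neg_sq, inv_pow, inv_pow, ← pow_mul, ← pow_mul, mul_neg, zpow_neg, ← zpow_natCast]
      push_cast
      ring_nf
  let F (x y z v : Fin 20) (s : Fin 10 → Bool) : ℝ :=
    (q + q⁻¹) ^ (Nat.card (Quot (Adj Fin.val (outer x y z v) s)) - 1)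
  have h2 (s₁ : Fin 10 → Bool) (s₂ : Fin (2 * n.natAbs) → Bool) :
      (q + q⁻¹) ^ ((code n).loops (Sum.elim s₁ s₂) - 1) =
        if ∀ j, s₂ j = false then F 18 19 18 19 s₁ else F 18 18 19 19 s₁ *
          (q + q⁻¹) ^ ((Finset.univ.filter fun j => s₂ j = true).card - 1) := by
    split_ifs with h
    · rw [loops_of_forall _ (by simpa using h)]
      simp [F]
    · rw [loops_of_exists _ (by simpa using h)]
      -- At least one loop lies in the outer part, so the truncated `- 1` can be taken from its
      -- count.
      have : 0 < Nat.card (Quot (Adj Fin.val (outer 18 18 19 19) s₁)) :=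
        Nat.card_pos_iff.2 ⟨⟨Quot.mk _ 0⟩, inferInstance⟩
      simp only [F, ← pow_add, Sum.elim_inl, Sum.elim_inr]
      congr 1
      exact Nat.sub_add_comm this
  refine mul_left_cancel₀ hd ?_
  calc
    _ = (q + q⁻¹) * ∑ s₁ : Fin 10 → Bool, ∑ s₂ : Fin (2 * n.natAbs) → Bool,
        ((∏ i, realWeight q (positive 0 (.inl i)) (s₁ i)) * ∏ j, w (s₂ j)) *
          (q + q⁻¹) ^ ((code n).loops (Sum.elim s₁ s₂) - 1) := by
      rw [h1, ← (Equiv.sumArrowEquivProdArrow _ _ _).symm.sum_comp, Fintype.sum_prod_type]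
      simp only [Fintype.prod_sum_type]
      rfl
    _ = ∑ s₁ : Fin 10 → Bool, (∏ i, realWeight q (positive 0 (.inl i)) (s₁ i)) *
        (w false ^ (2 * n.natAbs) * ((q + q⁻¹) * F 18 19 18 19 s₁) +
          (1 - w false ^ (2 * n.natAbs)) * F 18 18 19 19 s₁) := by
      rw [Finset.mul_sum]
      refine Finset.sum_congr rfl fun s₁ _ => ?_
      rw [← sum_column w hw]
      simp only [h2, mul_assoc, ← Finset.mul_sum]
      rw [mul_left_comm]
    _ = w false ^ (2 * n.natAbs) * ((q + q⁻¹) * outerSum q 18 19 18 19) +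
          (1 - w false ^ (2 * n.natAbs)) * outerSum q 18 18 19 19 := by
      simp only [outerSum, Finset.mul_sum, ← Finset.sum_add_distrib]
      refine Finset.sum_congr rfl fun s₁ _ => ?_
      simp only [F]
      ring
    _ = _ := by
      rw [outerSum_unknot hq.ne', outerSum_pretzel hq.ne', hwn]
      ring

end KT2

/-! ### The third derivative at `1`. -/

/-- In the Leibniz formula every term contains a derivative of `(q - a) ^ 4` of order at most three,
which vanishes at `a`. -/
theorem iteratedDeriv_three_sub_pow_mul (a : ℝ) {M : ℝ → ℝ} (hM : ContDiffAt ℝ 3 M a) :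
    iteratedDeriv 3 (fun q => (q - a) ^ 4 * M q) a = 0 := by
  rw [iteratedDeriv_fun_mul (by fun_prop) (by exact_mod_cast hM)]
  refine Finset.sum_eq_zero fun i hi => ?_
  have : iteratedDeriv i (fun q : ℝ => (q - a) ^ 4) a = 0 := by
    rw [iteratedDeriv_comp_sub_const (f := fun q => q ^ 4)]
    have : i < 4 := Finset.mem_range.1 hi
    simp
    right
    omega
  rw [this]
  ring

theorem mainTheorem6 (n : ℤ) (hn : n ≠ 0) :
    iteratedDeriv 3 (laurentFun (KT2 (-n)).jones) 1 =
      -iteratedDeriv 3 (laurentFun (KT2 n).jones) 1 := by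
  have hpos : ∀ᶠ q : ℝ in nhds 1, 0 < q := lt_mem_nhds one_pos
  have hJ (m : ℤ) : laurentFun (KT2 m).jones =ᶠ[nhds 1]
      fun q => 1 + (q ^ (4 * m) - 1) * KT2.pretzelDefect q :=
    hpos.mono fun q hq => KT2.laurentFun_jones_KT2 m hq
  have hzpow (m : ℤ) : ContDiffAt ℝ 3 (fun q : ℝ => q ^ m) 1 := by
    cases m with
    | ofNat m => simp only [Int.ofNat_eq_natCast, zpow_natCast]; fun_prop
    | negSucc m => simp only [zpow_negSucc]; fun_prop (disch := norm_num)
  have hR : ContDiffAt ℝ 3 KT2.pretzelDefect 1 := by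
    unfold KT2.pretzelDefect
    fun_prop (disch := norm_num)
  have hsmooth (m : ℤ) : ContDiffAt ℝ 3 (laurentFun (KT2 m).jones) 1 :=
    (contDiffAt_const.add (((hzpow _).sub contDiffAt_const).mul hR)).congr_of_eventuallyEq (hJ m)
  rw [eq_neg_iff_add_eq_zero, ← iteratedDeriv_fun_add (hsmooth _) (hsmooth _)]
  set k := 4 * n.natAbs with hk
  have hsum {q : ℝ} (hq : 0 < q) : q ^ (4 * -n) + q ^ (4 * n) = (q ^ k)⁻¹ + q ^ k := by
    have h : q ^ (4 * (n.natAbs : ℤ)) = q ^ k := by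
      rw [← zpow_natCast, hk]
      push_cast
      rfl
    rcases n.natAbs_eq with h' | h' <;> rw [h']
    · rw [mul_neg, zpow_neg, h]
    · rw [neg_neg, mul_neg, zpow_neg, h, add_comm]
  -- The cofactor of `(q - 1) ^ 4`: the geometric sum is left from `(q ^ k - 1) ^ 2`, and `(1 + q) ^
  -- 2` from the factor `(1 - q ^ 2) ^ 2` of `pretzelDefect`.
  let M (q : ℝ) : ℝ := (∑ i ∈ Finset.range k, q ^ i) ^ 2 * (q ^ k)⁻¹ *
    ((1 + q) ^ 2 * (1 + q ^ 4) * (1 + q ^ 4 + q ^ 8) * (q ^ 8)⁻¹)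
  have hM : ContDiffAt ℝ 3 M 1 := by
    fun_prop (disch := norm_num)
  have heq : (fun q => laurentFun (KT2 (-n)).jones q + laurentFun (KT2 n).jones q) =ᶠ[nhds 1]
      fun q => 2 + (q - 1) ^ 4 * M q := by
    filter_upwards [hpos, hJ n, hJ (-n)] with q hq h1 h2
    have hg := geom_sum_mul q k
    calc
      _ = 2 + (q ^ (4 * -n) + q ^ (4 * n) - 2) * KT2.pretzelDefect q := by
        rw [h1, h2]; ring
      _ = 2 + ((q ^ k - 1) ^ 2 * (q ^ k)⁻¹) * KT2.pretzelDefect q := by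
        rw [hsum hq]
        field_simp
        ring
      _ = _ := by
        rw [← hg]
        simp only [M, KT2.pretzelDefect]
        ring
  rw [heq.iteratedDeriv_eq, iteratedDeriv_const_add (by norm_num),
    iteratedDeriv_three_sub_pow_mul 1 hM]
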